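/- **Main Theorem.** Fix a dimension $d\ge 1$. For an even integer $L\ge 2$ let $\Lambda=(\mathbb Z/L\mathbb Z)^d$ be the cubic lattice torus of edge size $L$ and write $|\Lambda|=L^d=2N$. Color a vertex black if the sum of its coordinates (taken in $\{0,\dots,L-1\}$) is even and white if it is odd; write $y\perp x$ if $x$ and $y$ have opposite colors. A *weighting function* is a function $f:\Lambda\times\Lambda\to\mathbb R$ that is symmetric ($f(x,y)=f(y,x)$), positive ($f(x,y)>0$ for all $x,y\in\Lambda$), translation invariant ($f(x+a,y+a)=f(x,y)$ for all $x,y,a\in\Lambda$) and normalized ($\sum_{y\perp x}f(x,y)=1$ for every $x\in\Lambda$). Its smoothness $\mathrm{sm}(f)$ is the smallest real number such that $$|f(x,y)-f(x,y+u)|\le \mathrm{sm}(f)\, f(x,y)$$ for all $x,y\in\Lambda$ and all unit vectors $u=\pm e_1,\dots,\pm e_d$. A *tiling* $T$ of $\Lambda$ is a set of pairwise disjoint two-element subsets of $\Lambda$, each containing one black and one white vertex, whose union is $\Lambda$. The partition function is $Z(f)=\sum_T\prod_{\{x,y\}\in T}f(x,y)$, the sum being over all tilings $T$ of $\Lambda$,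 and the pressure is $p(f)=\frac1{2N}\log Z(f)$. Let $p_0=p(f_0)$, where $f_0\equiv 1/N$ is the constant weighting function. Then for every $\varepsilon>0$ there is a $\delta>0$, independent of $L$ (equivalently, of $N$), such that for every even $L\ge 2$ and every weighting function $f$ on $\Lambda=(\mathbb Z/L\mathbb Z)^d$, $$\mathrm{sm}(f)<\delta\quad\Longrightarrow\quad |p(f)-p_0|<\varepsilon .$$ -/

import Mathlib

noncomputable section

namespace Dimer

/-- The `d`-dimensional cubic lattice torus of edge size `L`. -/
abbrev Torus (d L : ℕ) : Type := Fin d → ZMod L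

/-- Half the number of vertices of the torus, i.e. `2 N = L ^ d` (for `L` even and `d ≥ 1`). -/
def halfVolume (d L : ℕ) : ℕ := L ^ d / 2

variable {d L : ℕ}

/-- A vertex is black if the sum of its coordinates, taken in `{0, …, L - 1}`, is even. -/
def IsBlack (x : Torus d L) : Prop := Even (∑ i, (x i).val)

/-- A vertex is white if the sum of its coordinates, taken in `{0, …, L - 1}`, is odd. -/
def IsWhite (x : Torus d L) : Prop := Odd (∑ i, (x i).val)

/-- The two vertices have opposite colors. -/
def OppositeColor (x y : Torus d L) : Prop :=
  (IsBlack x ∧ IsWhite y) ∨ (IsWhite x ∧ IsBlack y)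

/-- The unit vectors `± e_i`. -/
def IsUnitVector (u : Torus d L) : Prop :=
  ∃ i : Fin d, u = Pi.single i 1 ∨ u = -Pi.single i 1

open Classical in
/-- A weighting function: symmetric, positive, translation invariant and normalized.
Periodic functions on `ℤ^d × ℤ^d` are the same as functions on the torus squared. -/
structure Weighting (d L : ℕ) [NeZero L] where
  toFun : Torus d L → Torus d L → ℝ
  symm : ∀ x y, toFun x y = toFun y x
  pos : ∀ x y, 0 < toFun x y
  translation_invariant : ∀ x y a, toFun (x + a) (y + a) = toFun x y
  normalized : ∀ x, ∑ y ∈ Finset.univ.filter (fun y => OppositeColor x y), toFun x y = 1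

/-- A tiling: a set of two-element subsets of the torus, each containing one black and one white
vertex, that are disjoint and cover the torus. -/
def IsTiling (T : Finset (Sym2 (Torus d L))) : Prop :=
  (∀ s ∈ T, ∃ x y, IsBlack x ∧ IsWhite y ∧ s = s(x, y)) ∧
  ∀ v : Torus d L, ∃! s, s ∈ T ∧ v ∈ s

namespace Weighting

variable [NeZero L]

/-- The weight `f(x, y)` of the dimer `{x, y}`. -/
def dimerWeight (f : Weighting d L) (s : Sym2 (Torus d L)) : ℝ :=
  Sym2.lift ⟨f.toFun, f.symm⟩ s

open Classical in
/-- The partition function: the sum over all tilings of the product of the dimer weights. -/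
def partitionFunction (f : Weighting d L) : ℝ :=
  ∑ T ∈ Finset.univ.filter (fun T : Finset (Sym2 (Torus d L)) => IsTiling T),
    ∏ s ∈ T, f.dimerWeight s

/-- The pressure `p`, given by `exp (2 N p) = Z`. -/
def pressure (f : Weighting d L) : ℝ :=
  Real.log f.partitionFunction / (2 * (halfVolume d L : ℝ))

/-- The values `s` with `|f(x,y) - f(x,y+u)| ≤ s * f(x,y)` for all `x`, `y` and unit vectors `u`. -/
def smoothnessBounds (f : Weighting d L) : Set ℝ :=
  {s | ∀ x y u : Torus d L, IsUnitVector u →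
    |f.toFun x y - f.toFun x (y + u)| ≤ s * f.toFun x y}

/-- The smoothness `sm f`: the smallest smoothness bound (see `isLeast_sm`). -/
def sm (f : Weighting d L) : ℝ := sInf f.smoothnessBounds

/-- The infimum defining `sm f` is attained. -/
theorem isLeast_sm (hd : 0 < d) (f : Weighting d L) : IsLeast f.smoothnessBounds f.sm := by
  have hclosed : IsClosed f.smoothnessBounds := by
    have h : f.smoothnessBounds = ⋂ (x : Torus d L) (y : Torus d L) (u : Torus d L)
        (_ : IsUnitVector u),
        {s : ℝ | |f.toFun x y - f.toFun x (y + u)| ≤ s * f.toFun x y} := by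
      ext s; simp [smoothnessBounds]
    rw [h]
    refine isClosed_iInter fun x => isClosed_iInter fun y => isClosed_iInter fun u =>
      isClosed_iInter fun _ => isClosed_le continuous_const (by fun_prop)
  have hbdd : BddBelow f.smoothnessBounds := by
    refine ⟨0, fun s hs => ?_⟩
    have h := (abs_nonneg _).trans (hs 0 0 (Pi.single ⟨0, hd⟩ 1) ⟨⟨0, hd⟩, Or.inl rfl⟩)
    exact nonneg_of_mul_nonneg_left h (f.pos _ _)
  have hne : f.smoothnessBounds.Nonempty := by
    obtain ⟨s, hs⟩ := (Set.finite_range fun p : Torus d L × Torus d L × Torus d L =>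
      |f.toFun p.1 p.2.1 - f.toFun p.1 (p.2.1 + p.2.2)| / f.toFun p.1 p.2.1).bddAbove
    refine ⟨s, fun x y u _ => ?_⟩
    have h := hs ⟨(x, y, u), rfl⟩
    exact (div_le_iff₀ (f.pos x y)).1 h
  exact hclosed.isLeast_csInf hne hbdd

end Weighting

section Constant

variable [NeZero L]

theorem even_sum_val_iff (hL : Even L) (x : Torus d L) :
    Even (∑ i, (x i).val) ↔ ∑ i, ZMod.castHom hL.two_dvd (ZMod 2) (x i) = 0 := by
  rw [← ZMod.natCast_eq_zero_iff_even, Nat.cast_sum]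
  simp only [ZMod.natCast_val, ZMod.castHom_apply]

theorem isBlack_add_single (hL : Even L) (x : Torus d L) (i : Fin d) :
    IsBlack (x + Pi.single i 1) ↔ ¬ IsBlack x := by
  unfold IsBlack
  rw [even_sum_val_iff hL, even_sum_val_iff hL]
  have h : ∑ j, ZMod.castHom hL.two_dvd (ZMod 2) ((x + Pi.single i 1 : Torus d L) j)
      = ∑ j, ZMod.castHom hL.two_dvd (ZMod 2) (x j) + 1 := by
    simp only [Pi.add_apply, map_add, Finset.sum_add_distrib]
    congr 1
    rw [Finset.sum_eq_single i]
    · rw [Pi.single_eq_same, map_one]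
    · intro j _ hj
      rw [Pi.single_eq_of_ne hj, map_zero]
    · simp
  rw [h]
  generalize ∑ j, ZMod.castHom hL.two_dvd (ZMod 2) (x j) = t
  revert t
  decide

open Classical in
theorem card_oppositeColor (hd : 0 < d) (hL : Even L) (x : Torus d L) :
    (Finset.univ.filter (fun y => OppositeColor x y)).card = halfVolume d L := by
  have hw : ∀ y : Torus d L, IsWhite y ↔ ¬ IsBlack y := fun y => Nat.not_even_iff_odd.symm
  let B := Finset.univ.filter (fun y : Torus d L => IsBlack y)
  let W := Finset.univ.filter (fun y : Torus d L => ¬ IsBlack y)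
  have hcard : B.card = W.card := by
    refine Finset.card_bijective (fun y => y + Pi.single ⟨0, hd⟩ 1)
      (Equiv.addRight _).bijective fun y => ?_
    simp [B, W, isBlack_add_single hL]
  have hsum : B.card + W.card = L ^ d := by
    rw [Finset.card_filter_add_card_filter_not]
    simp [ZMod.card]
  have hB : B.card = halfVolume d L := by unfold halfVolume; omega
  by_cases hx : IsBlack x
  · rw [← hB, hcard]
    congr 1
    ext y
    simp [W, OppositeColor, hw, hx]
  · rw [← hB]
    congr 1
    ext y
    simp [B, OppositeColor, hw, hx]

theorem halfVolume_pos (hd : 0 < d) (hL : Even L) : 0 < halfVolume d L := by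
  have h0 : 0 < L := Nat.pos_of_ne_zero (NeZero.ne L)
  have h2 : 2 ≤ L := by obtain ⟨k, rfl⟩ := hL; omega
  have h : L ≤ L ^ d := Nat.le_self_pow hd.ne' L
  unfold halfVolume
  omega

/-- The constant weighting function `f₀ = 1 / N`. -/
def Weighting.const (hd : 0 < d) (hL : Even L) : Weighting d L where
  toFun _ _ := 1 / (halfVolume d L : ℝ)
  symm _ _ := rfl
  pos _ _ := by
    have := halfVolume_pos hd hL
    positivity
  translation_invariant _ _ _ := rfl
  normalized x := by
    have h : (halfVolume d L : ℝ) ≠ 0 := by exact_mod_cast (halfVolume_pos hd hL).ne'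
    rw [Finset.sum_const, card_oppositeColor hd hL, nsmul_eq_mul, mul_one_div_cancel h]

end Constant

end Dimer

end

/-! Numbering the black and the white vertices by `Fin N` makes `Z(f)` the permanent of a positive
doubly stochastic matrix, and `Z(f₀) = N! / N^N`. The lower bound is then van der Waerden's
inequality, valid for every weighting: `p(f) ≥ p₀`. Smoothness enters only in the upper bound.

Lower bound (`factorial_div_pow_le_sum_perm`), after Gurvits: the permanent is the mixed derivative
of `∏ X i` along the rows of the matrix. Each positive directional derivative preserves stability
(`IsPosStable.dirDeriv`) and costs a controlled factor in a capacity-type bound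
(`IsPosStable.le_dirDeriv`); the factors multiply to `n! / n^n`.

Upper bound (`log_sum_perm_sub_le`), in the spirit of the entropy proof of Bregman's theorem: reveal
a random matching row by row in a random order and compare its law with sequential sampling among
the unused columns. If all entries are at most `η`, then the logarithm of the permanent exceeds `log
(n! / n^n)` by at most `4 √η n`.

On a large torus, smoothness and normalization force every dimer weight to be small, since many
translates of `y` carry nearly the weight `f(x, y)` and these weights sum to at most 1. On a small
torus, smoothness makes `f` close to `1/N` pointwise. The threshold between the two cases depends
only on `d` and `ε`, so `δ` does not depend on `L`. -/

/-! ### Sums over injections, and the arithmetic-geometric mean inequality for multisets. -/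

/-- Injective maps from `Fin n` into the finite set `S`. -/
noncomputable def injectionsInto {κ : Type*} [Fintype κ] (n : ℕ) (S : Finset κ) :
    Finset (Fin n → κ) :=
  open Classical in
  Finset.univ.filter fun g => Function.Injective g ∧ ∀ i, g i ∈ S

theorem mem_injectionsInto {κ : Type*} [Fintype κ] {n : ℕ} {S : Finset κ} {g : Fin n → κ} :
    g ∈ injectionsInto n S ↔ Function.Injective g ∧ ∀ i, g i ∈ S := by
  classical
  simp [injectionsInto]

theorem injectionsInto_zero {κ : Type*} [Fintype κ] (S : Finset κ) :
    injectionsInto 0 S = {Fin.elim0} := by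
  ext g
  simp [mem_injectionsInto, Function.injective_of_subsingleton, Subsingleton.elim g Fin.elim0]

theorem sum_injectionsInto_succ {κ M : Type*} [Fintype κ] [DecidableEq κ] [AddCommMonoid M]
    (n : ℕ) (S : Finset κ) (F : (Fin (n + 1) → κ) → M) :
    ∑ g ∈ injectionsInto (n + 1) S, F g =
      ∑ j ∈ S, ∑ g ∈ injectionsInto n (S.erase j), F (Fin.cons j g) := by
  rw [Finset.sum_sigma']
  symm
  refine Finset.sum_bij (fun p _ => Fin.cons p.1 p.2) ?_ ?_ ?_ ?_
  · rintro ⟨j, g⟩ h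
    simp only [Finset.mem_sigma, mem_injectionsInto, Finset.mem_erase] at h
    obtain ⟨hj, hg, hS⟩ := h
    rw [mem_injectionsInto]
    refine ⟨Fin.cons_injective_iff.2 ⟨?_, hg⟩, ?_⟩
    · rintro ⟨i, hi⟩
      exact (hS i).1 hi
    · intro i
      refine Fin.cases ?_ (fun i => ?_) i
      · simpa using hj
      · simpa using (hS i).2
  · rintro ⟨j, g⟩ _ ⟨j', g'⟩ _ h
    have h := Fin.cons_injective2 h
    obtain ⟨rfl, rfl⟩ := h
    rfl
  · intro g hg
    rw [mem_injectionsInto] at hg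
    refine ⟨⟨g 0, fun i => g i.succ⟩, ?_, ?_⟩
    · simp only [Finset.mem_sigma, mem_injectionsInto, Finset.mem_erase]
      refine ⟨hg.2 0, fun a b h => Fin.succ_injective _ (hg.1 h), fun i => ⟨fun h => ?_, hg.2 _⟩⟩
      exact Fin.succ_ne_zero i (hg.1 h)
    · exact Fin.cons_self_tail g
  · intros
    rfl

theorem sum_injectionsInto_univ {M : Type*} [AddCommMonoid M] (n : ℕ)
    (F : (Fin n → Fin n) → M) :
    ∑ g ∈ injectionsInto n (Finset.univ : Finset (Fin n)), F g =
      ∑ σ : Equiv.Perm (Fin n), F σ := by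
  symm
  refine Finset.sum_bij (fun σ _ => ⇑σ) ?_ ?_ ?_ ?_
  · intro σ _
    simpa [mem_injectionsInto] using σ.injective
  · intro σ _ τ _ h
    exact DFunLike.coe_injective h
  · intro g hg
    rw [mem_injectionsInto] at hg
    exact ⟨Equiv.ofBijective g (Finite.injective_iff_bijective.1 hg.1), Finset.mem_univ _, rfl⟩
  · intros
    rfl

theorem Multiset.sum_pos_of_forall_pos {s : Multiset ℝ} (hs : s ≠ 0) (h : ∀ x ∈ s, 0 < x) :
    0 < s.sum := by
  obtain ⟨a, ha⟩ := Multiset.exists_mem_of_ne_zero hs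
  obtain ⟨t, rfl⟩ := Multiset.exists_cons_of_mem ha
  rw [Multiset.sum_cons]
  have h1 := h a ha
  have h2 : 0 ≤ t.sum := Multiset.sum_nonneg fun x hx => (h x (Multiset.mem_cons_of_mem hx)).le
  linarith

theorem Multiset.prod_le_sum_div_card_pow (s : Multiset ℝ) (h : ∀ x ∈ s, 0 ≤ x) :
    s.prod ≤ (s.sum / s.card) ^ s.card := by
  induction s using Quotient.inductionOn with
  | h l =>
    simp only [Multiset.quot_mk_to_coe, Multiset.prod_coe, Multiset.sum_coe, Multiset.coe_card,
      Multiset.mem_coe] at h ⊢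
    rcases Nat.eq_zero_or_pos l.length with h0 | h0
    · rw [List.length_eq_zero_iff.1 h0]
      simp
    have hn : ∀ i : Fin l.length, 0 ≤ l[i] := fun i => h _ (List.getElem_mem _)
    have key := Real.geom_mean_le_arith_mean (Finset.univ : Finset (Fin l.length))
      (fun _ => 1) (fun i => l[i]) (fun _ _ => zero_le_one)
      (by simpa using h0) (fun i _ => hn i)
    simp only [Real.rpow_one, one_mul, Finset.sum_const, Finset.card_univ, Fintype.card_fin,
      nsmul_eq_mul, mul_one] at key
    have e1 : ∏ i : Fin l.length, l[i] = l.prod := by simp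
    have e2 : ∑ i : Fin l.length, l[i] = l.sum := by simp
    rw [e1, e2] at key
    have hp : 0 ≤ l.prod := e1 ▸ Finset.prod_nonneg fun i _ => hn i
    calc l.prod = (l.prod ^ ((l.length : ℝ)⁻¹)) ^ l.length :=
          (Real.rpow_inv_natCast_pow hp h0.ne').symm
      _ ≤ _ := pow_le_pow_left₀ (Real.rpow_nonneg hp _) key _

/-! ### Directional derivatives and restriction of polynomials to lines. -/

open MvPolynomial in
/-- The derivative of `p` in the direction `a`. -/
noncomputable def dirDeriv {ι : Type*} [Fintype ι] (a : ι → ℝ) (p : MvPolynomial ι ℝ) :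
    MvPolynomial ι ℝ :=
  ∑ i, C (a i) * pderiv i p

/-- The restriction of `p` to the line `t ↦ v + t a`. -/
noncomputable def lineRestrict {ι K : Type*} [CommRing K] [Algebra ℝ K] (v a : ι → K) :
    MvPolynomial ι ℝ →ₐ[ℝ] Polynomial K :=
  MvPolynomial.aeval fun i => Polynomial.C (v i) + Polynomial.C (a i) * Polynomial.X

theorem eval_lineRestrict {ι K : Type*} [CommRing K] [Algebra ℝ K] (v a : ι → K)
    (p : MvPolynomial ι ℝ) (t : K) :
    (lineRestrict v a p).eval t = MvPolynomial.aeval (fun i => v i + a i * t) p := by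
  have h : ((Polynomial.aeval t : Polynomial K →ₐ[K] K).restrictScalars ℝ).comp
      (lineRestrict v a) = MvPolynomial.aeval (fun i => v i + a i * t) := by
    ext i
    simp [lineRestrict]
  have := DFunLike.congr_fun h p
  simpa [Polynomial.coe_aeval_eq_eval] using this

theorem derivative_lineRestrict {ι K : Type*} [Fintype ι] [CommRing K] [Algebra ℝ K]
    (v : ι → K) (a : ι → ℝ) (p : MvPolynomial ι ℝ) :
    Polynomial.derivative (lineRestrict v (fun i => algebraMap ℝ K (a i)) p) =
      lineRestrict v (fun i => algebraMap ℝ K (a i)) (dirDeriv a p) := by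
  classical
  induction p using MvPolynomial.induction_on with
  | C r =>
    simp [dirDeriv, lineRestrict, Polynomial.algebraMap_apply]
  | add p q hp hq =>
    have : dirDeriv a (p + q) = dirDeriv a p + dirDeriv a q := by
      simp [dirDeriv, mul_add, Finset.sum_add_distrib]
    rw [map_add, Polynomial.derivative_add, hp, hq, this, map_add]
  | mul_X p j hp =>
    have : dirDeriv a (p * MvPolynomial.X j) =
        dirDeriv a p * MvPolynomial.X j + p * MvPolynomial.C (a j) := by
      simp only [dirDeriv, Derivation.leibniz, MvPolynomial.pderiv_X, smul_eq_mul, mul_add,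
        Finset.sum_add_distrib, Finset.sum_mul]
      rw [add_comm]
      congr 1
      · exact Finset.sum_congr rfl fun i _ => by ring
      · rw [Finset.sum_eq_single j]
        · simp [mul_comm]
        · intro i _ hi
          simp [hi]
        · simp
    rw [map_mul, Polynomial.derivative_mul, hp, this, map_add, map_mul, map_mul]
    congr 1
    simp [lineRestrict, Polynomial.algebraMap_apply]

theorem coeff_lineRestrict_monomial {ι K : Type*} [CommRing K] [Algebra ℝ K] (v a : ι → K)
    (e : ι →₀ ℕ) :
    (lineRestrict v a (MvPolynomial.monomial e 1)).natDegree ≤ e.degree ∧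
      (lineRestrict v a (MvPolynomial.monomial e 1)).coeff e.degree =
        MvPolynomial.aeval a (MvPolynomial.monomial e (1 : ℝ)) := by
  induction e using Finsupp.induction_linear with
  | zero => simp
  | add e f he hf =>
    have h : (MvPolynomial.monomial (e + f) (1 : ℝ)) =
        MvPolynomial.monomial e 1 * MvPolynomial.monomial f 1 := by
      simp [MvPolynomial.monomial_mul]
    have hd : (e + f).degree = e.degree + f.degree := map_add _ _ _
    rw [h, map_mul, map_mul, hd]
    refine ⟨Polynomial.natDegree_mul_le.trans (add_le_add he.1 hf.1), ?_⟩
    rw [Polynomial.coeff_mul_add_eq_of_natDegree_le he.1 hf.1, he.2, hf.2]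
  | single i k =>
    have h1 : (Polynomial.C (v i) + Polynomial.C (a i) * Polynomial.X).natDegree ≤ 1 := by
      compute_degree
    rw [MvPolynomial.monomial_eq]
    simp only [map_one, one_mul, Finsupp.degree_single, pow_zero, Finsupp.prod_single_index,
      map_pow, lineRestrict, MvPolynomial.aeval_X]
    refine ⟨(Polynomial.natDegree_pow_le_of_le k h1).trans (by simp), ?_⟩
    have := Polynomial.coeff_pow_of_natDegree_le (n := 1) (m := k) h1
    rw [mul_one] at this
    rw [this]
    simp [Polynomial.coeff_C]

/-- Only the top power of `t` in `p(v + t a)` is free of `v`. Where `p(a) ≠ 0`, this fixes the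
number of roots on the line, counted with multiplicity over a field where the restriction splits. -/
theorem MvPolynomial.IsHomogeneous.coeff_lineRestrict {ι K : Type*} [CommRing K] [Algebra ℝ K]
    {m : ℕ} {p : MvPolynomial ι ℝ} (hp : p.IsHomogeneous m) (v a : ι → K) :
    (lineRestrict v a p).natDegree ≤ m ∧
      (lineRestrict v a p).coeff m = MvPolynomial.aeval a p := by
  have hterm : ∀ e ∈ p.support, MvPolynomial.monomial e (p.coeff e) =
      MvPolynomial.C (p.coeff e) * MvPolynomial.monomial e 1 := by
    intro e _
    rw [MvPolynomial.C_mul_monomial, mul_one]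
  have hdeg : ∀ e ∈ p.support, e.degree = m := by
    intro e he
    rw [Finsupp.degree_eq_weight_one]
    exact hp (MvPolynomial.mem_support_iff.1 he)
  rw [p.as_sum, Finset.sum_congr rfl hterm, map_sum, map_sum]
  constructor
  · refine Polynomial.natDegree_sum_le_of_forall_le _ _ fun e he => ?_
    rw [map_mul]
    refine Polynomial.natDegree_mul_le.trans ?_
    have h := (coeff_lineRestrict_monomial v a e).1
    rw [hdeg e he] at h
    have h0 : (lineRestrict v a (MvPolynomial.C (p.coeff e))).natDegree = 0 := by
      simp [lineRestrict, Polynomial.algebraMap_apply]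
    omega
  · rw [Polynomial.finsetSum_coeff]
    refine Finset.sum_congr rfl fun e he => ?_
    have h := (coeff_lineRestrict_monomial v a e).2
    rw [hdeg e he] at h
    have h0 : lineRestrict v a (MvPolynomial.C (p.coeff e)) =
        Polynomial.C (algebraMap ℝ K (p.coeff e)) := by
      simp [lineRestrict, Polynomial.algebraMap_apply]
    rw [map_mul, map_mul, h0, Polynomial.coeff_C_mul, h]
    simp

/-! ### Stable polynomials and Gurvits's inequality. -/

/-- A homogeneous polynomial of degree `m` without zeros in the product of open upper half planes
and positive on the positive orthant. -/
structure IsPosStable {ι : Type*} (m : ℕ) (p : MvPolynomial ι ℝ) : Prop where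
  homogeneous : p.IsHomogeneous m
  ne_zero : ∀ z : ι → ℂ, (∀ i, 0 < (z i).im) → MvPolynomial.aeval z p ≠ 0
  pos : ∀ v : ι → ℝ, (∀ i, 0 < v i) → 0 < MvPolynomial.aeval v p

theorem aeval_ofReal {ι : Type*} (p : MvPolynomial ι ℝ) (v : ι → ℝ) :
    MvPolynomial.aeval (fun i => (v i : ℂ)) p = ((MvPolynomial.aeval v p : ℝ) : ℂ) := by
  exact MvPolynomial.aeval_algebraMap_apply ℂ v p

namespace IsPosStable

variable {ι : Type*} {m : ℕ} {p : MvPolynomial ι ℝ}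

theorem natDegree_lineRestrict_real (hp : IsPosStable m p) (v : ι → ℝ) {a : ι → ℝ}
    (ha : ∀ i, 0 < a i) : (lineRestrict v a p).natDegree = m := by
  obtain ⟨h1, h2⟩ := hp.homogeneous.coeff_lineRestrict v a
  exact Polynomial.natDegree_eq_of_le_of_coeff_ne_zero h1 (h2 ▸ (hp.pos a ha).ne')

theorem natDegree_lineRestrict_complex (hp : IsPosStable m p) (v : ι → ℂ) {a : ι → ℝ}
    (ha : ∀ i, 0 < a i) : (lineRestrict v (fun i => (a i : ℂ)) p).natDegree = m := by
  obtain ⟨h1, h2⟩ := hp.homogeneous.coeff_lineRestrict v (fun i => (a i : ℂ))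
  refine Polynomial.natDegree_eq_of_le_of_coeff_ne_zero h1 ?_
  rw [h2, aeval_ofReal]
  exact_mod_cast (hp.pos a ha).ne'

theorem lineRestrict_map (p : MvPolynomial ι ℝ) (v a : ι → ℝ) :
    (lineRestrict v a p).map (algebraMap ℝ ℂ) =
      lineRestrict (fun i => (v i : ℂ)) (fun i => (a i : ℂ)) p := by
  have h : (Polynomial.mapAlgHom (Algebra.ofId ℝ ℂ)).comp (lineRestrict v a) =
      lineRestrict (fun i => (v i : ℂ)) (fun i => (a i : ℂ)) := by
    ext i : 1
    simp [lineRestrict, Algebra.ofId]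
  exact DFunLike.congr_fun h p

/-- A non-real root or its conjugate would lie in the upper half plane, and there `v + s a` has all
imaginary parts positive, against stability. -/
theorem splits_lineRestrict (hp : IsPosStable m p) (v : ι → ℝ) {a : ι → ℝ}
    (ha : ∀ i, 0 < a i) : (lineRestrict v a p).Splits := by
  refine Polynomial.Splits.of_splits_map (algebraMap ℝ ℂ) (IsAlgClosed.splits _) ?_
  intro r hr
  have hev : ((lineRestrict v a p).map (algebraMap ℝ ℂ)).eval r = 0 :=
    Polynomial.isRoot_of_mem_roots hr
  have upper : ∀ s : ℂ, 0 < s.im → ((lineRestrict v a p).map (algebraMap ℝ ℂ)).eval s ≠ 0 := by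
    intro s hs
    rw [lineRestrict_map, eval_lineRestrict]
    refine hp.ne_zero _ fun i => ?_
    simpa using mul_pos (ha i) hs
  have hconj : ((lineRestrict v a p).map (algebraMap ℝ ℂ)).eval (starRingEnd ℂ r) = 0 := by
    rw [Polynomial.eval_map_algebraMap] at hev ⊢
    have := Polynomial.aeval_conj (lineRestrict v a p) r
    rw [this, hev, map_zero]
  have h1 : ¬ 0 < r.im := fun h => upper r h hev
  have h2 : ¬ 0 < -r.im := fun h => upper _ (by simpa using h) hconj
  have h0 : r.im = 0 := by linarith
  exact ⟨r.re, Complex.ext (by simp) (by simp [h0])⟩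

theorem roots_neg (hp : IsPosStable m p) {v a : ι → ℝ} (hv : ∀ i, 0 < v i)
    (ha : ∀ i, 0 < a i) {r : ℝ} (hr : r ∈ (lineRestrict v a p).roots) : r < 0 := by
  by_contra! h
  have h0 : (lineRestrict v a p).eval r = 0 := Polynomial.isRoot_of_mem_roots hr
  rw [eval_lineRestrict] at h0
  exact (hp.pos _ fun i => add_pos_of_pos_of_nonneg (hv i) (mul_nonneg (ha i).le h)).ne' h0

theorem eval_zero_lineRestrict {K : Type*} [CommRing K] [Algebra ℝ K] (v a : ι → K)
    (p : MvPolynomial ι ℝ) : (lineRestrict v a p).eval 0 = MvPolynomial.aeval v p := by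
  rw [eval_lineRestrict]
  simp

theorem dirDeriv_div [Fintype ι] (hp : IsPosStable m p) {v a : ι → ℝ} (hv : ∀ i, 0 < v i)
    (ha : ∀ i, 0 < a i) :
    MvPolynomial.aeval v (dirDeriv a p) / MvPolynomial.aeval v p =
      ((lineRestrict v a p).roots.map fun r => 1 / (0 - r)).sum := by
  have h0 : (lineRestrict v a p).eval 0 ≠ 0 := by
    rw [eval_zero_lineRestrict]
    exact (hp.pos v hv).ne'
  rw [← (hp.splits_lineRestrict v ha).eval_derivative_div_eval_of_ne_zero h0,
    eval_zero_lineRestrict]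
  have := derivative_lineRestrict v a p
  simp only [Algebra.algebraMap_self, RingHom.id_apply] at this
  rw [this, eval_zero_lineRestrict]

/-- A Gauss–Lucas argument: the roots `r` of `p(z + t a)` all lie in the open lower half plane, so
every term `1 / (0 - r)` of the logarithmic derivative at `t = 0` has negative imaginary part and
the sum cannot vanish. -/
protected theorem dirDeriv [Fintype ι] (hp : IsPosStable (m + 1) p) {a : ι → ℝ}
    (ha : ∀ i, 0 < a i) : IsPosStable m (dirDeriv a p) where
  homogeneous := by
    refine MvPolynomial.IsHomogeneous.sum _ _ _ fun i _ => ?_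
    simpa using (MvPolynomial.isHomogeneous_C ι (a i)).mul (hp.homogeneous.pderiv (i := i))
  ne_zero := by
    intro z hz h
    set U := lineRestrict z (fun i => (a i : ℂ)) p with hU
    have h0 : U.eval 0 ≠ 0 := by
      rw [eval_zero_lineRestrict]
      exact hp.ne_zero z hz
    have h1 := (IsAlgClosed.splits U).eval_derivative_div_eval_of_ne_zero h0
    have h2 : U.derivative.eval 0 = 0 := by
      have := derivative_lineRestrict z a p
      simp only [Complex.coe_algebraMap] at this
      rw [hU, this, eval_zero_lineRestrict, h]
    rw [h2, zero_div] at h1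
    have hroots : ∀ r ∈ U.roots, r.im < 0 := by
      intro r hr
      by_contra! hr0
      have he : U.eval r = 0 := Polynomial.isRoot_of_mem_roots hr
      rw [hU, eval_lineRestrict] at he
      refine hp.ne_zero _ (fun i => ?_) he
      simpa using add_pos_of_pos_of_nonneg (hz i) (mul_nonneg (ha i).le hr0)
    have hne : U.roots ≠ 0 := by
      refine (IsAlgClosed.splits U).roots_ne_zero ?_
      rw [hU, hp.natDegree_lineRestrict_complex z ha]
      omega
    have h3 : 0 < ((U.roots.map fun r => 1 / (0 - r)).map fun s : ℂ => -s.im).sum := by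
      refine Multiset.sum_pos_of_forall_pos (by simpa using hne) fun x hx => ?_
      simp only [Multiset.map_map, Multiset.mem_map, Function.comp] at hx
      obtain ⟨r, hr, rfl⟩ := hx
      have hr0 := hroots r hr
      have hn : 0 < Complex.normSq r := Complex.normSq_pos.2 fun h => by simp [h] at hr0
      simp only [zero_sub, one_div, Complex.inv_im, Complex.neg_im, Complex.normSq_neg]
      rw [neg_neg, ← neg_div]
      exact div_pos (neg_pos.2 hr0) hn
    have h4 : ((U.roots.map fun r => 1 / (0 - r)).map fun s : ℂ => -s.im).sum = 0 := by
      have := map_multiset_sum (-Complex.imAddGroupHom) (U.roots.map fun r => 1 / (0 - r))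
      rw [← h1] at this
      rw [map_zero] at this
      exact this.symm
    exact h3.ne' h4
  pos := by
    intro v hv
    have h0 := hp.pos v hv
    have h : 0 < MvPolynomial.aeval v (dirDeriv a p) / MvPolynomial.aeval v p := by
      rw [hp.dirDeriv_div hv ha]
      refine Multiset.sum_pos_of_forall_pos ?_ fun x hx => ?_
      · have := (hp.splits_lineRestrict v ha).roots_ne_zero
          (by rw [hp.natDegree_lineRestrict_real v ha]; omega)
        simpa using this
      · obtain ⟨r, hr, rfl⟩ := Multiset.mem_map.1 hx
        have := hp.roots_neg hv ha hr
        exact one_div_pos.2 (by linarith)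
    rw [div_pos_iff_of_pos_right h0] at h
    exact h

/-- On the line, `p` factors as `p(v) ∏ (1 + t / (-r))` with all `r < 0`. The mean of the factors is
governed by the logarithmic derivative, and the arithmetic-geometric mean inequality bounds their
product. -/
theorem aeval_line_le [Fintype ι] (hp : IsPosStable m p) (hm : 0 < m) {v a : ι → ℝ}
    (hv : ∀ i, 0 < v i) (ha : ∀ i, 0 < a i) {t : ℝ} (ht : 0 ≤ t) :
    MvPolynomial.aeval (fun i => v i + a i * t) p ≤ MvPolynomial.aeval v p *
      (1 + t * (MvPolynomial.aeval v (dirDeriv a p) / MvPolynomial.aeval v p) / m) ^ m := by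
  set R := lineRestrict v a p with hR
  have hs := hp.splits_lineRestrict v ha
  have hcard : R.roots.card = m := by
    rw [← hs.natDegree_eq_card_roots, hp.natDegree_lineRestrict_real v ha]
  have hneg : ∀ r ∈ R.roots, r < 0 := fun r hr => hp.roots_neg hv ha hr
  have e1 : R.eval t = R.eval 0 * (R.roots.map fun r => 1 + t * (1 / (0 - r))).prod := by
    rw [hs.eval_eq_prod_roots, hs.eval_eq_prod_roots, mul_assoc, ← Multiset.prod_map_mul]
    congr 2
    refine Multiset.map_congr rfl fun r hr => ?_
    have := (hneg r hr).ne
    field_simp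
    ring
  have e2 := Multiset.prod_le_sum_div_card_pow (R.roots.map fun r => 1 + t * (1 / (0 - r))) (by
    intro x hx
    obtain ⟨r, hr, rfl⟩ := Multiset.mem_map.1 hx
    have : 0 < 1 / (0 - r) := one_div_pos.2 (by linarith [hneg r hr])
    positivity)
  rw [Multiset.card_map, hcard, Multiset.sum_map_add, Multiset.sum_map_mul_left,
    ← hp.dirDeriv_div hv ha] at e2
  simp only [Multiset.map_const', Multiset.sum_replicate, hcard, nsmul_eq_mul, mul_one] at e2
  rw [eval_zero_lineRestrict, hR, eval_lineRestrict] at e1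
  rw [e1]
  refine mul_le_mul_of_nonneg_left (e2.trans_eq ?_) (hp.pos v hv).le
  have : (m : ℝ) ≠ 0 := by exact_mod_cast hm.ne'
  congr 1
  field_simp

theorem le_dirDeriv [Fintype ι] (hp : IsPosStable (m + 1) p) {v a : ι → ℝ}
    (hv : ∀ i, 0 < v i) (ha : ∀ i, 0 < a i) {c : ℝ}
    (h : ∀ t : ℝ, 0 < t → c * t ≤ MvPolynomial.aeval (fun i => v i + a i * t) p) :
    c * ((m : ℝ) / (m + 1)) ^ m ≤ MvPolynomial.aeval v (dirDeriv a p) := by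
  have hA := hp.pos v hv
  have hB := (hp.dirDeriv ha).pos v hv
  set A := MvPolynomial.aeval v p
  set B := MvPolynomial.aeval v (dirDeriv a p)
  have key : ∀ t : ℝ, 0 < t → c * t ≤ A * (1 + t * (B / A) / ((m + 1 : ℕ) : ℝ)) ^ (m + 1) :=
    fun t ht => (h t ht).trans (hp.aeval_line_le m.succ_pos hv ha ht.le)
  rcases Nat.eq_zero_or_pos m with rfl | hm
  · simp only [pow_zero, mul_one]
    by_contra! hlt
    -- In degree one the bound reads `c t ≤ A + B t`. This `t` makes `(c - B) t` equal to `A + 1`, a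
    -- contradiction.
    have h1 := key ((A + 1) / (c - B)) (div_pos (by linarith) (by linarith))
    have h2 : A * (1 + (A + 1) / (c - B) * (B / A) / ((0 + 1 : ℕ) : ℝ)) ^ (0 + 1) =
        A + (A + 1) / (c - B) * B := by
      have h3 : c - B ≠ 0 := (sub_pos.2 hlt).ne'
      simp only [zero_add, Nat.cast_one, div_one, pow_one]
      rw [mul_add, mul_one, mul_left_comm, mul_div_cancel₀ _ hA.ne']
    rw [h2] at h1
    have h3 : (c - B) * ((A + 1) / (c - B)) = A + 1 := by
      exact mul_div_cancel₀ _ (sub_pos.2 hlt).ne'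
    nlinarith
  · have hm' : (0 : ℝ) < m := by exact_mod_cast hm
    -- This `t` minimizes the upper bound divided by `t`.
    have h1 := key ((m + 1) * A / (m * B)) (by positivity)
    have h2 : 1 + (m + 1) * A / (m * B) * (B / A) / ((m + 1 : ℕ) : ℝ) = (m + 1) / m := by
      push_cast
      field_simp
    rw [h2, pow_succ] at h1
    have h3 : c ≤ B * ((m + 1 : ℝ) / m) ^ m := by
      have : c * ((m + 1) * A / (m * B)) * (m * B / ((m + 1) * A)) ≤
          A * (((m + 1 : ℝ) / m) ^ m * ((m + 1) / m)) * (m * B / ((m + 1) * A)) :=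
        mul_le_mul_of_nonneg_right h1 (by positivity)
      calc c = c * ((m + 1) * A / (m * B)) * (m * B / ((m + 1) * A)) := by field_simp
        _ ≤ _ := this
        _ = _ := by field_simp
    calc c * ((m : ℝ) / (m + 1)) ^ m
        ≤ B * ((m + 1 : ℝ) / m) ^ m * ((m : ℝ) / (m + 1)) ^ m :=
          mul_le_mul_of_nonneg_right h3 (by positivity)
      _ = B * (((m + 1 : ℝ) / m) * ((m : ℝ) / (m + 1))) ^ m := by rw [mul_pow, mul_assoc]
      _ = B := by
        have : ((m + 1 : ℝ) / m) * ((m : ℝ) / (m + 1)) = 1 := by field_simp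
        rw [this, one_pow, mul_one]

end IsPosStable

/-! ### Iterated derivatives and van der Waerden's bound. -/

/-- The iterated derivative of `p` in the directions `a 0, …, a (m - 1)`. -/
noncomputable def iterDirDeriv {ι : Type*} [Fintype ι] :
    (m : ℕ) → (Fin m → ι → ℝ) → MvPolynomial ι ℝ → MvPolynomial ι ℝ
  | 0, _, p => p
  | m + 1, a, p => iterDirDeriv m (fun j => a j.succ) (dirDeriv (a 0) p)

/-- Each derivative uses up one variable `x j` of the lower bound `c ∏ x j`. The costs `(k / (k +
1)) ^ k` telescope to `m! / m ^ m`. The shift `w` keeps the base point in the open orthant even when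
no variables remain. -/
theorem IsPosStable.le_iterDirDeriv {ι : Type*} [Fintype ι] (m : ℕ) (a : Fin m → ι → ℝ)
    (ha : ∀ j i, 0 < a j i) (p : MvPolynomial ι ℝ) (hp : IsPosStable m p) (c : ℝ)
    (h : ∀ w : ι → ℝ, (∀ i, 0 < w i) → ∀ x : Fin m → ℝ, (∀ j, 0 < x j) →
      c * ∏ j, x j ≤ MvPolynomial.aeval (fun i => w i + ∑ j, x j * a j i) p)
    (w : ι → ℝ) (hw : ∀ i, 0 < w i) :
    c * ((m.factorial : ℝ) / (m : ℝ) ^ m) ≤ MvPolynomial.aeval w (iterDirDeriv m a p) := by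
  induction m generalizing p c with
  | zero => simpa [iterDirDeriv] using h w hw Fin.elim0 fun j => j.elim0
  | succ m ih =>
    have key := ih (fun j => a j.succ) (fun j => ha j.succ) (dirDeriv (a 0) p)
      (hp.dirDeriv (ha 0)) (c * ((m : ℝ) / (m + 1)) ^ m) (by
        intro w hw x hx
        rw [mul_right_comm]
        refine hp.le_dirDeriv (fun i => ?_) (ha 0) fun t ht => ?_
        · exact add_pos_of_pos_of_nonneg (hw i)
            (Finset.sum_nonneg fun j _ => (mul_pos (hx j) (ha j.succ i)).le)
        · have := h w hw (Fin.cons t x) (fun j => Fin.cases (by simpa) (by simpa) j)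
          simp only [Fin.prod_univ_succ, Fin.sum_univ_succ, Fin.cons_zero, Fin.cons_succ] at this
          refine le_trans (le_of_eq (by ring)) (this.trans_eq ?_)
          congr 2
          ext i
          ring)
    refine le_trans (le_of_eq ?_) key
    rw [Nat.factorial_succ]
    push_cast
    rcases Nat.eq_zero_or_pos m with rfl | hm
    · simp
    · have hm' : (0 : ℝ) < m := by exact_mod_cast hm
      rw [div_pow, pow_succ]
      field_simp

theorem dirDeriv_C_mul {ι : Type*} [Fintype ι] (a : ι → ℝ) (r : ℝ) (p : MvPolynomial ι ℝ) :
    dirDeriv a (MvPolynomial.C r * p) = MvPolynomial.C r * dirDeriv a p := by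
  simp only [dirDeriv, MvPolynomial.pderiv_C_mul, Finset.mul_sum]
  exact Finset.sum_congr rfl fun i _ => by ring

theorem dirDeriv_sum {ι κ : Type*} [Fintype ι] (a : ι → ℝ) (s : Finset κ)
    (p : κ → MvPolynomial ι ℝ) :
    dirDeriv a (∑ k ∈ s, p k) = ∑ k ∈ s, dirDeriv a (p k) := by
  simp only [dirDeriv, map_sum, Finset.mul_sum]
  exact Finset.sum_comm

theorem iterDirDeriv_sum {ι κ : Type*} [Fintype ι] (m : ℕ) (a : Fin m → ι → ℝ) (s : Finset κ)
    (c : κ → ℝ) (p : κ → MvPolynomial ι ℝ) :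
    iterDirDeriv m a (∑ k ∈ s, MvPolynomial.C (c k) * p k) =
      ∑ k ∈ s, MvPolynomial.C (c k) * iterDirDeriv m a (p k) := by
  induction m generalizing p with
  | zero => rfl
  | succ m ih => simp only [iterDirDeriv, dirDeriv_sum, dirDeriv_C_mul, ih]

theorem dirDeriv_prod_X {ι : Type*} [Fintype ι] [DecidableEq ι] (a : ι → ℝ) (S : Finset ι) :
    dirDeriv a (∏ i ∈ S, MvPolynomial.X i) =
      ∑ j ∈ S, MvPolynomial.C (a j) * ∏ i ∈ S.erase j, MvPolynomial.X i := by
  induction S using Finset.induction_on with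
  | empty => simp [dirDeriv]
  | insert k S hk ih =>
    have h : dirDeriv a (MvPolynomial.X k * ∏ i ∈ S, MvPolynomial.X i) =
        MvPolynomial.C (a k) * ∏ i ∈ S, MvPolynomial.X i +
          MvPolynomial.X k * dirDeriv a (∏ i ∈ S, MvPolynomial.X i) := by
      simp only [dirDeriv, MvPolynomial.pderiv_mul, mul_add, Finset.sum_add_distrib,
        Finset.mul_sum]
      congr 1
      · rw [Finset.sum_eq_single k]
        · simp
        · intro i _ hi
          rw [MvPolynomial.pderiv_X_of_ne hi.symm]
          simp
        · simp
      · exact Finset.sum_congr rfl fun i _ => mul_left_comm _ _ _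
    rw [Finset.prod_insert hk, h, ih, Finset.sum_insert hk, Finset.erase_insert hk,
      Finset.mul_sum, add_right_inj]
    refine Finset.sum_congr rfl fun j hj => ?_
    have hjk : k ≠ j := fun h => hk (h ▸ hj)
    rw [Finset.erase_insert_of_ne hjk, Finset.prod_insert fun h => hk (Finset.mem_of_mem_erase h),
      mul_left_comm]

theorem iterDirDeriv_prod_X {ι : Type*} [Fintype ι] (m : ℕ) (a : Fin m → ι → ℝ)
    (S : Finset ι) (hS : S.card = m) :
    iterDirDeriv m a (∏ i ∈ S, MvPolynomial.X i) =
      MvPolynomial.C (∑ g ∈ injectionsInto m S, ∏ j, a j (g j)) := by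
  classical
  induction m generalizing S with
  | zero => simp [iterDirDeriv, injectionsInto_zero, Finset.card_eq_zero.1 hS]
  | succ m ih =>
    rw [iterDirDeriv, dirDeriv_prod_X, iterDirDeriv_sum, sum_injectionsInto_succ, map_sum]
    refine Finset.sum_congr rfl fun j hj => ?_
    rw [ih _ _ (by rw [Finset.card_erase_of_mem hj, hS]; rfl), ← map_mul, Finset.mul_sum]
    simp [Fin.prod_univ_succ]

theorem isPosStable_prod_X {ι : Type*} [Fintype ι] :
    IsPosStable (Fintype.card ι) (∏ i : ι, (MvPolynomial.X i : MvPolynomial ι ℝ)) where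
  homogeneous := by
    have := MvPolynomial.IsHomogeneous.prod (Finset.univ : Finset ι)
      (fun i => (MvPolynomial.X i : MvPolynomial ι ℝ)) (fun _ => 1)
      (fun i _ => MvPolynomial.isHomogeneous_X ℝ i)
    simpa using this
  ne_zero z hz := by
    rw [map_prod, Finset.prod_ne_zero_iff]
    intro i _ h
    have := hz i
    rw [MvPolynomial.aeval_X] at h
    simp [h] at this
  pos v hv := by
    rw [map_prod]
    exact Finset.prod_pos fun i _ => by simpa using hv i

/-- The van der Waerden bound for the permanent of a positive doubly stochastic matrix. -/
theorem factorial_div_pow_le_sum_perm {n : ℕ} (A : Fin n → Fin n → ℝ) (hA : ∀ i j, 0 < A i j)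
    (hrow : ∀ i, ∑ j, A i j = 1) (hcol : ∀ j, ∑ i, A i j = 1) :
    (n.factorial : ℝ) / (n : ℝ) ^ n ≤ ∑ σ : Equiv.Perm (Fin n), ∏ i, A i (σ i) := by
  have hp : IsPosStable n (∏ i : Fin n, (MvPolynomial.X i : MvPolynomial (Fin n) ℝ)) := by
    simpa using isPosStable_prod_X (ι := Fin n)
  have h := hp.le_iterDirDeriv n A hA _ 1 (by
    intro w hw x hx
    rw [one_mul, map_prod]
    simp only [MvPolynomial.aeval_X]
    -- The row sums split each `x j` among the columns; the column sums provide the weights for the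
    -- weighted arithmetic-geometric mean inequality.
    calc ∏ j, x j = ∏ j, x j ^ (∑ i, A j i) := by simp [hrow]
      _ = ∏ j, ∏ i, x j ^ A j i := by
        refine Finset.prod_congr rfl fun j _ => ?_
        rw [Real.rpow_sum_of_pos (hx j)]
      _ = ∏ i, ∏ j, x j ^ A j i := Finset.prod_comm
      _ ≤ _ := by
        refine Finset.prod_le_prod (fun i _ => Finset.prod_nonneg fun j _ =>
          Real.rpow_nonneg (hx j).le _) fun i _ => ?_
        have := Real.geom_mean_le_arith_mean_weighted Finset.univ (fun j => A j i) x
          (fun j _ => (hA j i).le) (hcol i) (fun j _ => (hx j).le)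
        refine this.trans ?_
        simp only [mul_comm (A _ i)]
        linarith [hw i]) (fun _ => 1) (fun _ => one_pos)
  rw [iterDirDeriv_prod_X n A _ (by simp), sum_injectionsInto_univ] at h
  simpa using h

/-! ### Upper bound for permanents: sequential sampling and relative entropy. -/

/-- The product is the probability of `g` when each `i` in turn picks an unused element `j` of `S`
with probability proportional to `A i j`. The total is 0 rather than 1 if `S` has fewer than `n`
elements. -/
theorem sum_injectionsInto_div_le_one {κ : Type*} [Fintype κ] [DecidableEq κ] (n : ℕ)
    (A : Fin n → κ → ℝ) (hA : ∀ i j, 0 < A i j) (S : Finset κ) :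
    ∑ g ∈ injectionsInto n S,
      ∏ i, A i (g i) / ∑ j ∈ S.filter (fun j => ∀ k < i, g k ≠ j), A i j ≤ 1 := by
  induction n generalizing S with
  | zero => simp [injectionsInto_zero]
  | succ n ih =>
    rw [sum_injectionsInto_succ]
    have h : ∀ j ∈ S, ∑ g ∈ injectionsInto n (S.erase j), ∏ i : Fin (n + 1),
        A i ((Fin.cons j g : Fin (n + 1) → κ) i) /
          ∑ l ∈ S.filter (fun l => ∀ k < i, (Fin.cons j g : Fin (n + 1) → κ) k ≠ l), A i l ≤
        A 0 j / ∑ l ∈ S, A 0 l := by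
      intro j hj
      have h1 := ih (fun i => A i.succ) (fun i => hA i.succ) (S.erase j)
      have hpos : 0 ≤ A 0 j / ∑ l ∈ S, A 0 l :=
        div_nonneg (hA 0 j).le (Finset.sum_nonneg fun l _ => (hA 0 l).le)
      refine le_trans (le_of_eq ?_) (mul_le_of_le_one_right hpos h1)
      rw [Finset.mul_sum]
      refine Finset.sum_congr rfl fun g _ => ?_
      rw [Fin.prod_univ_succ]
      congr 1
      · simp
      · refine Finset.prod_congr rfl fun i _ => ?_
        rw [Fin.cons_succ]
        congr 2
        ext l
        simp only [Finset.mem_filter, Finset.mem_erase, Fin.forall_fin_succ, Fin.cons_zero,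
          Fin.cons_succ, Fin.succ_pos, Fin.succ_lt_succ_iff, true_implies]
        constructor
        · rintro ⟨h1, h2, h3⟩
          exact ⟨⟨h2.symm, h1⟩, h3⟩
        · rintro ⟨⟨h2, h1⟩, h3⟩
          exact ⟨h1, h2.symm, h3⟩
    refine (Finset.sum_le_sum h).trans ?_
    rw [← Finset.sum_div]
    exact div_self_le_one _

/-- Rows are visited in increasing order of `t`. The columns still unused at row `i` are among the
`σ k` with `t i ≤ t k`; ties only enlarge the denominators. -/
theorem sum_perm_div_le_one {n : ℕ} (A : Fin n → Fin n → ℝ) (hA : ∀ i j, 0 < A i j)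
    {α : Type*} [LinearOrder α] (t : Fin n → α) :
    ∑ σ : Equiv.Perm (Fin n),
      ∏ i, A i (σ i) / ∑ k with t i ≤ t k, A i (σ k) ≤ 1 := by
  let τ := Tuple.sort t
  have h := sum_injectionsInto_div_le_one n (fun i => A (τ i)) (fun i => hA (τ i)) Finset.univ
  rw [sum_injectionsInto_univ, ← Equiv.sum_comp (Equiv.mulRight τ)] at h
  refine le_trans ?_ h
  refine Finset.sum_le_sum fun σ _ => ?_
  rw [← Equiv.prod_comp τ]
  refine Finset.prod_le_prod (fun i _ => div_nonneg (hA _ _).le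
    (Finset.sum_nonneg fun k _ => (hA _ _).le)) fun i _ => ?_
  refine div_le_div_of_nonneg_left (hA _ _).le ?_ ?_
  · refine Finset.sum_pos (fun _ _ => hA _ _) ⟨σ (τ i), ?_⟩
    simp only [Finset.mem_filter, Finset.mem_univ, true_and]
    intro k hk h
    exact hk.ne (by simpa using h)
  · rw [← Finset.sum_image (f := fun l => A (τ i) l) (g := fun k => σ k)
      (s := Finset.univ.filter fun k => t (τ i) ≤ t k) σ.injective.injOn]
    refine Finset.sum_le_sum_of_subset_of_nonneg ?_ fun _ _ _ => (hA _ _).le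
    intro l hl
    simp only [Finset.mem_filter, Finset.mem_univ, true_and] at hl
    simp only [Finset.mem_image, Finset.mem_filter, Finset.mem_univ, true_and]
    refine ⟨σ.symm l, ?_, by simp⟩
    by_contra! hlt
    have hlt' : τ.symm (σ.symm l) < i := by
      by_contra! hle
      have := Tuple.monotone_sort t hle
      simp only [Function.comp] at this
      change t (τ i) ≤ t (τ (τ.symm (σ.symm l))) at this
      rw [Equiv.apply_symm_apply] at this
      exact absurd hlt this.not_gt
    exact hl _ hlt' (by simp)

/-- Gibbs' inequality between the law proportional to `∏ A i (σ i)` and the subprobability of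
`sum_perm_div_le_one`, proved through `log x ≤ x - 1`. -/
theorem log_sum_perm_mul_le {n : ℕ} (A : Fin n → Fin n → ℝ) (hA : ∀ i j, 0 < A i j)
    {α : Type*} [LinearOrder α] (t : Fin n → α) :
    Real.log (∑ σ : Equiv.Perm (Fin n), ∏ i, A i (σ i)) *
        ∑ σ : Equiv.Perm (Fin n), ∏ i, A i (σ i) ≤
      ∑ σ : Equiv.Perm (Fin n), (∏ i, A i (σ i)) *
        ∑ i, Real.log (∑ k with t i ≤ t k, A i (σ k)) := by
  set Z := ∑ σ : Equiv.Perm (Fin n), ∏ i, A i (σ i) with hZ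
  have hw : ∀ σ : Equiv.Perm (Fin n), 0 < ∏ i, A i (σ i) := fun σ =>
    Finset.prod_pos fun i _ => hA _ _
  have hZ0 : 0 < Z := Finset.sum_pos (fun σ _ => hw σ) Finset.univ_nonempty
  have hr : ∀ (σ : Equiv.Perm (Fin n)) (i : Fin n), 0 < ∑ k with t i ≤ t k, A i (σ k) :=
    fun σ i => Finset.sum_pos (fun _ _ => hA _ _) ⟨i, by simp⟩
  have h1 := sum_perm_div_le_one A hA t
  have h2 : ∀ σ : Equiv.Perm (Fin n), (∏ i, A i (σ i)) *
      (Real.log Z - ∑ i, Real.log (∑ k with t i ≤ t k, A i (σ k))) ≤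
      Z * ∏ i, A i (σ i) / ∑ k with t i ≤ t k, A i (σ k) - ∏ i, A i (σ i) := by
    intro σ
    have hR : 0 < ∏ i, ∑ k with t i ≤ t k, A i (σ k) := Finset.prod_pos fun i _ => hr σ i
    rw [← Real.log_prod fun i _ => (hr σ i).ne', ← Real.log_div hZ0.ne' hR.ne']
    refine (mul_le_mul_of_nonneg_left (Real.log_le_sub_one_of_pos (div_pos hZ0 hR))
      (hw σ).le).trans_eq ?_
    rw [Finset.prod_div_distrib]
    ring
  have h3 := Finset.sum_le_sum fun σ (_ : σ ∈ Finset.univ) => h2 σ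
  rw [Finset.sum_sub_distrib, ← Finset.mul_sum, ← hZ] at h3
  simp only [mul_sub] at h3
  rw [Finset.sum_sub_distrib, ← Finset.sum_mul, ← hZ] at h3
  nlinarith

/-! ### Averaging over independent uniform arrival times. -/

section Averaging

variable {n : ℕ}

theorem card_mul_sum_apply (i : Fin n) (g : Fin n → ℝ) :
    (n : ℝ) * ∑ t : Fin n → Fin n, g (t i) = ((n : ℝ) ^ n) * ∑ c, g c := by
  have : NeZero n := ⟨i.pos.ne'⟩
  have h : ∀ s : Fin n, ∑ t : Fin n → Fin n, g (t i) = ∑ t : Fin n → Fin n, g (t i + s) := by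
    intro s
    rw [← Equiv.sum_comp (Equiv.addRight (Pi.single i s : Fin n → Fin n))]
    simp
  calc (n : ℝ) * ∑ t : Fin n → Fin n, g (t i)
      = ∑ s : Fin n, ∑ t : Fin n → Fin n, g (t i) := by simp
    _ = ∑ s : Fin n, ∑ t : Fin n → Fin n, g (t i + s) := Finset.sum_congr rfl fun s _ => h s
    _ = ∑ t : Fin n → Fin n, ∑ s : Fin n, g (t i + s) := Finset.sum_comm
    _ = ∑ t : Fin n → Fin n, ∑ s : Fin n, g s :=
      Finset.sum_congr rfl fun t _ => Equiv.sum_comp (Equiv.addLeft (t i)) g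
    _ = _ := by simp

/-- Shifting the coordinate `t k` cyclically leaves the sum over `t` unchanged and does not touch `t
i`; averaging over the shifts makes `t k` uniform and independent of `t i`. -/
theorem card_mul_sum_apply₂ {i k : Fin n} (hik : i ≠ k) (g : Fin n → Fin n → ℝ) :
    (n : ℝ) * ∑ t : Fin n → Fin n, g (t i) (t k) = ∑ t : Fin n → Fin n, ∑ c, g (t i) c := by
  have : NeZero n := ⟨i.pos.ne'⟩
  have h : ∀ s : Fin n, ∑ t : Fin n → Fin n, g (t i) (t k) =
      ∑ t : Fin n → Fin n, g (t i) (t k + s) := by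
    intro s
    rw [← Equiv.sum_comp (Equiv.addRight (Pi.single k s : Fin n → Fin n))]
    simp [hik]
  calc (n : ℝ) * ∑ t : Fin n → Fin n, g (t i) (t k)
      = ∑ s : Fin n, ∑ t : Fin n → Fin n, g (t i) (t k) := by simp
    _ = ∑ s : Fin n, ∑ t : Fin n → Fin n, g (t i) (t k + s) :=
      Finset.sum_congr rfl fun s _ => h s
    _ = ∑ t : Fin n → Fin n, ∑ s : Fin n, g (t i) (t k + s) := Finset.sum_comm
    _ = _ := Finset.sum_congr rfl fun t _ => Equiv.sum_comp (Equiv.addLeft (t k)) (g (t i))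

theorem sum_ite_le_div (m : ℝ) (c : Fin n) :
    ∑ c' : Fin n, (if c ≤ c' then 1 / m else 0) = ((n : ℝ) - c) / m := by
  rw [← Finset.sum_filter, Finset.sum_const]
  have : (Finset.univ.filter fun c' : Fin n => c ≤ c') = Finset.Ici c := by
    ext
    simp
  rw [this, Fin.card_Ici, nsmul_eq_mul, Nat.cast_sub c.is_lt.le]
  ring

/-- Jensen's inequality for `log`, through the tangent at `η + (n - c) / n`. Given `t i = c`, the
inner sum has mean `a i + (1 - a i) (n - c) / n`, because `i` itself always counts and any other `k`
counts with probability `(n - c) / n`. This mean is at most the tangent point. -/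
theorem sum_log_sum_le (i : Fin n) (a : Fin n → ℝ) (ha : ∀ k, 0 < a k) (hsum : ∑ k, a k = 1)
    {η : ℝ} (hη : a i ≤ η) :
    ∑ t : Fin n → Fin n, Real.log (∑ k with t i ≤ t k, a k) ≤
      ∑ t : Fin n → Fin n, Real.log (η + ((n : ℝ) - t i) / n) := by
  have hn : (0 : ℝ) < n := by exact_mod_cast i.pos
  have hη0 : 0 < η := (ha i).trans_le hη
  set m : Fin n → ℝ := fun c => η + ((n : ℝ) - c) / n with hm
  have hc : ∀ c : Fin n, (0 : ℝ) ≤ ((n : ℝ) - c) / n := fun c =>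
    div_nonneg (sub_nonneg.2 (by exact_mod_cast c.is_lt.le)) hn.le
  have hc1 : ∀ c : Fin n, ((n : ℝ) - c) / n ≤ 1 := fun c => by
    rw [div_le_one hn]
    linarith [(Nat.cast_nonneg (c : ℕ) : (0 : ℝ) ≤ (c : ℕ))]
  have hm0 : ∀ c, 0 < m c := fun c => add_pos_of_pos_of_nonneg hη0 (hc c)
  have hr : ∀ t : Fin n → Fin n, 0 < ∑ k with t i ≤ t k, a k := fun t =>
    Finset.sum_pos (fun k _ => ha k) ⟨i, by simp⟩
  have h1 : ∀ t : Fin n → Fin n, Real.log (∑ k with t i ≤ t k, a k) ≤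
      Real.log (m (t i)) + ((∑ k with t i ≤ t k, a k) / m (t i) - 1) := by
    intro t
    have := Real.log_le_sub_one_of_pos (div_pos (hr t) (hm0 (t i)))
    rw [Real.log_div (hr t).ne' (hm0 _).ne'] at this
    linarith
  have h2 : ∀ k, ∑ t : Fin n → Fin n, (if t i ≤ t k then 1 / m (t i) else 0) =
      ∑ t : Fin n → Fin n, if k = i then 1 / m (t i) else ((n : ℝ) - t i) / n / m (t i) := by
    intro k
    by_cases hk : k = i
    · simp [hk]
    · simp only [hk, if_false]
      refine mul_left_cancel₀ hn.ne' ?_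
      rw [card_mul_sum_apply₂ (Ne.symm hk) fun c c' => if c ≤ c' then 1 / m c else 0,
        Finset.mul_sum]
      refine Finset.sum_congr rfl fun t _ => ?_
      rw [sum_ite_le_div]
      field_simp
  have h3 : ∑ t : Fin n → Fin n, (∑ k with t i ≤ t k, a k) / m (t i) ≤
      ∑ t : Fin n → Fin n, (1 : ℝ) := by
    calc ∑ t : Fin n → Fin n, (∑ k with t i ≤ t k, a k) / m (t i)
        = ∑ t : Fin n → Fin n, ∑ k, a k * (if t i ≤ t k then 1 / m (t i) else 0) := by
          refine Finset.sum_congr rfl fun t _ => ?_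
          rw [Finset.sum_filter, Finset.sum_div]
          refine Finset.sum_congr rfl fun k _ => ?_
          split_ifs <;> ring
      _ = ∑ k, a k * ∑ t : Fin n → Fin n, (if t i ≤ t k then 1 / m (t i) else 0) := by
          rw [Finset.sum_comm]
          simp only [Finset.mul_sum]
      _ = ∑ t : Fin n → Fin n, ∑ k, a k *
            (if k = i then 1 / m (t i) else ((n : ℝ) - t i) / n / m (t i)) := by
          simp only [h2, Finset.mul_sum]
          exact Finset.sum_comm
      _ ≤ _ := by
          refine Finset.sum_le_sum fun t _ => ?_
          have e : ∀ k, a k * (if k = i then 1 / m (t i) else ((n : ℝ) - t i) / n / m (t i)) =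
              a k * (((n : ℝ) - t i) / n / m (t i)) +
                if k = i then a i * (1 / m (t i) - ((n : ℝ) - t i) / n / m (t i)) else 0 := by
            intro k
            split_ifs with hk
            · rw [hk]
              ring
            · ring
          simp only [e, Finset.sum_add_distrib, ← Finset.sum_mul, hsum, Finset.sum_ite_eq',
            Finset.mem_univ, if_true]
          rw [one_mul, ← sub_div, ← mul_div_assoc, ← add_div, div_le_one (hm0 _)]
          have := mul_le_of_le_one_right (ha i).le (sub_le_self 1 (hc (t i)))
          simp only [hm]
          linarith
  have h4 := Finset.sum_le_sum fun t (_ : t ∈ Finset.univ) => h1 t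
  rw [Finset.sum_add_distrib, Finset.sum_sub_distrib] at h4
  linarith

end Averaging

/-- The entropy inequality `log_sum_perm_mul_le` is summed over all arrival times `t`; with the
order of summation exchanged, every `σ` receives the same bound. Independent times with ties replace
a random permutation of the rows. -/
theorem log_sum_perm_le {n : ℕ} (hn : 0 < n) (A : Fin n → Fin n → ℝ) (hA : ∀ i j, 0 < A i j)
    (hrow : ∀ i, ∑ j, A i j = 1) {η : ℝ} (hη : ∀ i j, A i j ≤ η) :
    Real.log (∑ σ : Equiv.Perm (Fin n), ∏ i, A i (σ i)) ≤
      ∑ c : Fin n, Real.log (η + ((n : ℝ) - c) / n) := by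
  set Z := ∑ σ : Equiv.Perm (Fin n), ∏ i, A i (σ i) with hZ
  have hn' : (0 : ℝ) < n := by exact_mod_cast hn
  have hw : ∀ σ : Equiv.Perm (Fin n), 0 < ∏ i, A i (σ i) := fun σ =>
    Finset.prod_pos fun i _ => hA _ _
  have hZ0 : 0 < Z := Finset.sum_pos (fun σ _ => hw σ) Finset.univ_nonempty
  have h1 := Finset.sum_le_sum fun (t : Fin n → Fin n) (_ : t ∈ Finset.univ) =>
    log_sum_perm_mul_le A hA t
  rw [Finset.sum_const, Finset.sum_comm] at h1
  simp only [← hZ, nsmul_eq_mul, Finset.card_univ, Fintype.card_fun, Fintype.card_fin,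
    Nat.cast_pow] at h1
  have h2 : ∀ σ : Equiv.Perm (Fin n), ∑ t : Fin n → Fin n, (∏ i, A i (σ i)) *
      ∑ i, Real.log (∑ k with t i ≤ t k, A i (σ k)) ≤ (∏ i, A i (σ i)) *
        ((n : ℝ) ^ n * ∑ c : Fin n, Real.log (η + ((n : ℝ) - c) / n)) := by
    intro σ
    rw [← Finset.mul_sum, Finset.sum_comm]
    refine mul_le_mul_of_nonneg_left ?_ (hw σ).le
    have h3 : ∀ i, ∑ t : Fin n → Fin n, Real.log (∑ k with t i ≤ t k, A i (σ k)) ≤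
        ((n : ℝ) ^ n * ∑ c : Fin n, Real.log (η + ((n : ℝ) - c) / n)) / n := by
      intro i
      refine (sum_log_sum_le i (fun k => A i (σ k)) (fun k => hA _ _)
        (by rw [Equiv.sum_comp σ (A i), hrow]) (hη i (σ i))).trans_eq ?_
      rw [eq_div_iff hn'.ne', mul_comm]
      exact card_mul_sum_apply i fun c => Real.log (η + ((n : ℝ) - c) / n)
    refine (Finset.sum_le_sum fun i _ => h3 i).trans_eq ?_
    rw [Finset.sum_const, Finset.card_univ, Fintype.card_fin, nsmul_eq_mul]
    field_simp
  have h4 := h1.trans (Finset.sum_le_sum fun σ _ => h2 σ)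
  rw [← Finset.sum_mul, ← hZ] at h4
  have h5 : 0 < (n : ℝ) ^ n * Z := by positivity
  refine le_of_mul_le_mul_left (le_trans (le_of_eq ?_) (h4.trans_eq ?_)) h5 <;> ring

theorem sum_one_div_sqrt_le (n : ℕ) :
    ∑ k ∈ Finset.range n, 1 / Real.sqrt (k + 1) ≤ 2 * Real.sqrt n := by
  induction n with
  | zero => simp
  | succ n ih =>
    rw [Finset.sum_range_succ]
    have h1 : 0 ≤ Real.sqrt n := Real.sqrt_nonneg _
    have h2 : 0 < Real.sqrt (n + 1) := Real.sqrt_pos.2 (by positivity)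
    have h3 : Real.sqrt n ^ 2 = n := Real.sq_sqrt (by positivity)
    have h4 : Real.sqrt (n + 1) ^ 2 = n + 1 := Real.sq_sqrt (by positivity)
    have h5 : 1 / Real.sqrt (n + 1) ≤ 2 * (Real.sqrt (n + 1) - Real.sqrt n) := by
      rw [div_le_iff₀ h2]
      nlinarith [sq_nonneg (Real.sqrt (n + 1) - Real.sqrt n)]
    push_cast
    linarith

theorem log_one_add_le_two_mul_sqrt {x : ℝ} (hx : 0 ≤ x) : Real.log (1 + x) ≤ 2 * Real.sqrt x := by
  have h := Real.sqrt_nonneg x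
  have h1 : 1 + x ≤ (1 + Real.sqrt x) ^ 2 := by nlinarith [Real.sq_sqrt hx]
  have h2 := Real.log_le_log (by linarith) h1
  rw [Real.log_pow] at h2
  have h3 := Real.log_le_sub_one_of_pos (show 0 < 1 + Real.sqrt x by linarith)
  push_cast at h2
  linarith

/-- Since `n! / n ^ n = ∏ (k + 1) / n`, the comparison is termwise: each `k` contributes `log (1 + η
n / (k + 1)) ≤ 2 √(η n / (k + 1))`, and these bounds sum to at most `4 √η n`. -/
theorem log_sum_perm_sub_le {n : ℕ} (hn : 0 < n) (A : Fin n → Fin n → ℝ)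
    (hA : ∀ i j, 0 < A i j) (hrow : ∀ i, ∑ j, A i j = 1) {η : ℝ} (hη : ∀ i j, A i j ≤ η) :
    Real.log (∑ σ : Equiv.Perm (Fin n), ∏ i, A i (σ i)) -
        Real.log ((n.factorial : ℝ) / (n : ℝ) ^ n) ≤ 4 * Real.sqrt η * n := by
  have hn' : (0 : ℝ) < n := by exact_mod_cast hn
  have hη0 : 0 < η := (hA ⟨0, hn⟩ ⟨0, hn⟩).trans_le (hη _ _)
  have h1 := log_sum_perm_le hn A hA hrow hη
  have h2 : ∑ c : Fin n, Real.log (η + ((n : ℝ) - c) / n) =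
      ∑ k ∈ Finset.range n, Real.log (η + ((k : ℝ) + 1) / n) := by
    rw [Fin.sum_univ_eq_sum_range (fun c => Real.log (η + ((n : ℝ) - c) / n)),
      ← Finset.sum_range_reflect]
    refine Finset.sum_congr rfl fun k hk => ?_
    have hk := Finset.mem_range.1 hk
    rw [Nat.sub_sub, Nat.cast_sub (by omega)]
    push_cast
    congr 3
    ring
  have h3 : Real.log ((n.factorial : ℝ) / (n : ℝ) ^ n) =
      ∑ k ∈ Finset.range n, Real.log (((k : ℝ) + 1) / n) := by
    rw [← Real.log_prod fun k _ => (by positivity), Finset.prod_div_distrib,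
      ← Finset.prod_range_add_one_eq_factorial]
    simp only [Finset.prod_const, Finset.card_range]
    push_cast
    rfl
  rw [h2] at h1
  rw [h3]
  have h4 : ∀ k ∈ Finset.range n, Real.log (η + ((k : ℝ) + 1) / n) -
      Real.log (((k : ℝ) + 1) / n) ≤ 2 * Real.sqrt (η * n) * (1 / Real.sqrt (k + 1)) := by
    intro k _
    rw [← Real.log_div (by positivity) (by positivity)]
    have e : (η + ((k : ℝ) + 1) / n) / (((k : ℝ) + 1) / n) = 1 + η * n / (k + 1) := by
      field_simp
      ring
    rw [e]
    refine (log_one_add_le_two_mul_sqrt (by positivity)).trans_eq ?_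
    rw [Real.sqrt_div (by positivity)]
    ring
  have h5 := Finset.sum_le_sum h4
  rw [Finset.sum_sub_distrib, ← Finset.mul_sum] at h5
  have h6 := mul_le_mul_of_nonneg_left (sum_one_div_sqrt_le n)
    (show 0 ≤ 2 * Real.sqrt (η * n) by positivity)
  have h7 : 2 * Real.sqrt (η * n) * (2 * Real.sqrt n) = 4 * Real.sqrt η * n := by
    rw [Real.sqrt_mul hη0.le]
    linear_combination 4 * Real.sqrt η * Real.mul_self_sqrt hn'.le
  linarith

/-! ### The partition function as a permanent. -/

namespace Dimer

theorem isWhite_iff_not_isBlack {d L : ℕ} (x : Torus d L) : IsWhite x ↔ ¬ IsBlack x :=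
  Nat.not_even_iff_odd.symm

/-- Numberings of the black and of the white vertices by `Fin N`. -/
structure ColorEnumeration (d L N : ℕ) where
  black : Fin N → Torus d L
  white : Fin N → Torus d L
  black_injective : Function.Injective black
  white_injective : Function.Injective white
  isBlack_iff : ∀ x, IsBlack x ↔ ∃ i, black i = x
  isWhite_iff : ∀ x, IsWhite x ↔ ∃ i, white i = x

namespace ColorEnumeration

variable {d L N : ℕ} (e : ColorEnumeration d L N)

theorem isBlack (i : Fin N) : IsBlack (e.black i) := (e.isBlack_iff _).2 ⟨i, rfl⟩

theorem isWhite (i : Fin N) : IsWhite (e.white i) := (e.isWhite_iff _).2 ⟨i, rfl⟩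

theorem black_ne_white (i j : Fin N) : e.black i ≠ e.white j := fun h =>
  (isWhite_iff_not_isBlack _).1 (e.isWhite j) (h ▸ e.isBlack i)

theorem dimer_eq_iff {i j k l : Fin N} :
    s(e.black i, e.white j) = s(e.black k, e.white l) ↔ i = k ∧ j = l := by
  rw [Sym2.eq_iff]
  constructor
  · rintro (⟨h1, h2⟩ | ⟨h1, h2⟩)
    · exact ⟨e.black_injective h1, e.white_injective h2⟩
    · exact absurd h1 (e.black_ne_white _ _)
  · rintro ⟨rfl, rfl⟩
    exact Or.inl ⟨rfl, rfl⟩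

theorem black_mem_iff {i j k : Fin N} : e.black i ∈ s(e.black j, e.white k) ↔ i = j := by
  rw [Sym2.mem_iff]
  constructor
  · rintro (h | h)
    · exact e.black_injective h
    · exact absurd h (e.black_ne_white _ _)
  · rintro rfl
    exact Or.inl rfl

theorem white_mem_iff {i j k : Fin N} : e.white i ∈ s(e.black j, e.white k) ↔ i = k := by
  rw [Sym2.mem_iff]
  constructor
  · rintro (h | h)
    · exact absurd h.symm (e.black_ne_white _ _)
    · exact e.white_injective h
  · rintro rfl
    exact Or.inr rfl

open Classical in
theorem partitionFunction_eq [NeZero L] (f : Weighting d L) :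
    f.partitionFunction =
      ∑ σ : Equiv.Perm (Fin N), ∏ i, f.toFun (e.black i) (e.white (σ i)) := by
  unfold Weighting.partitionFunction
  symm
  refine Finset.sum_bij
    (fun σ _ => Finset.univ.image fun i => s(e.black i, e.white (σ i))) ?_ ?_ ?_ ?_
  · intro σ _
    simp only [Finset.mem_filter, Finset.mem_univ, true_and]
    refine ⟨fun s hs => ?_, fun v => ?_⟩
    · obtain ⟨i, -, rfl⟩ := Finset.mem_image.1 hs
      exact ⟨_, _, e.isBlack i, e.isWhite (σ i), rfl⟩
    · by_cases hv : IsBlack v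
      · obtain ⟨i, rfl⟩ := (e.isBlack_iff v).1 hv
        refine ⟨s(e.black i, e.white (σ i)), ⟨Finset.mem_image_of_mem _ (Finset.mem_univ i),
          e.black_mem_iff.2 rfl⟩, ?_⟩
        rintro s ⟨hs, hi⟩
        obtain ⟨j, -, rfl⟩ := Finset.mem_image.1 hs
        rw [e.black_mem_iff.1 hi]
      · obtain ⟨k, rfl⟩ := (e.isWhite_iff v).1 ((isWhite_iff_not_isBlack v).2 hv)
        refine ⟨s(e.black (σ.symm k), e.white (σ (σ.symm k))),
          ⟨Finset.mem_image_of_mem (fun i => s(e.black i, e.white (σ i))) (Finset.mem_univ _),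
          e.white_mem_iff.2 (by simp)⟩, ?_⟩
        rintro s ⟨hs, hi⟩
        obtain ⟨j, -, rfl⟩ := Finset.mem_image.1 hs
        rw [e.white_mem_iff.1 hi]
        simp
  · intro σ _ τ _ h
    ext1 i
    have hi : s(e.black i, e.white (σ i)) ∈
        Finset.univ.image fun i => s(e.black i, e.white (τ i)) := by
      rw [← h]
      exact Finset.mem_image_of_mem (fun i => s(e.black i, e.white (σ i))) (Finset.mem_univ i)
    obtain ⟨j, -, hj⟩ := Finset.mem_image.1 hi
    obtain ⟨rfl, h2⟩ := e.dimer_eq_iff.1 hj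
    exact h2.symm
  · intro T hT
    simp only [Finset.mem_filter, Finset.mem_univ, true_and] at hT
    obtain ⟨hT1, hT2⟩ := hT
    have form : ∀ s ∈ T, ∃ i j, s = s(e.black i, e.white j) := by
      intro s hs
      obtain ⟨x, y, hx, hy, rfl⟩ := hT1 s hs
      obtain ⟨i, rfl⟩ := (e.isBlack_iff x).1 hx
      obtain ⟨j, rfl⟩ := (e.isWhite_iff y).1 hy
      exact ⟨i, j, rfl⟩
    have partner : ∀ i, ∃ j, s(e.black i, e.white j) ∈ T := by
      intro i
      obtain ⟨s, ⟨hs, hi⟩, -⟩ := hT2 (e.black i)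
      obtain ⟨k, j, rfl⟩ := form s hs
      obtain rfl := e.black_mem_iff.1 hi
      exact ⟨j, hs⟩
    choose g hg using partner
    have hinj : Function.Injective g := by
      intro i j hij
      have h := (hT2 (e.white (g i))).unique ⟨hg i, e.white_mem_iff.2 rfl⟩
        ⟨hg j, e.white_mem_iff.2 hij⟩
      exact (e.dimer_eq_iff.1 h).1
    refine ⟨Equiv.ofBijective g (Finite.injective_iff_bijective.1 hinj), Finset.mem_univ _, ?_⟩
    ext s
    simp only [Finset.mem_image, Finset.mem_univ, true_and, Equiv.ofBijective_apply]
    constructor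
    · rintro ⟨i, rfl⟩
      exact hg i
    · intro hs
      obtain ⟨i, j, rfl⟩ := form s hs
      exact ⟨i, (hT2 (e.black i)).unique ⟨hg i, e.black_mem_iff.2 rfl⟩
        ⟨hs, e.black_mem_iff.2 rfl⟩⟩
  · intro σ _
    rw [Finset.prod_image fun i _ j _ h => (e.dimer_eq_iff.1 h).1]
    rfl

open Classical in
theorem sum_white [NeZero L] (f : Weighting d L) (i : Fin N) :
    ∑ j, f.toFun (e.black i) (e.white j) = 1 := by
  rw [← f.normalized (e.black i), ← Finset.sum_image (g := e.white)
    (f := fun y => f.toFun (e.black i) y) e.white_injective.injOn]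
  refine Finset.sum_congr ?_ fun _ _ => rfl
  ext y
  have h : OppositeColor (e.black i) y ↔ IsWhite y := by
    simp [OppositeColor, isWhite_iff_not_isBlack, e.isBlack i]
  simp only [Finset.mem_image, Finset.mem_filter, Finset.mem_univ, true_and, h, e.isWhite_iff]

open Classical in
theorem sum_black [NeZero L] (f : Weighting d L) (j : Fin N) :
    ∑ i, f.toFun (e.black i) (e.white j) = 1 := by
  rw [← f.normalized (e.white j), ← Finset.sum_image (g := e.black)
    (f := fun y => f.toFun y (e.white j)) e.black_injective.injOn]
  refine Finset.sum_congr ?_ fun _ _ => f.symm _ _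
  ext y
  have h : OppositeColor (e.white j) y ↔ IsBlack y := by
    simp [OppositeColor, e.isWhite j, (isWhite_iff_not_isBlack _).1 (e.isWhite j)]
  simp only [Finset.mem_image, Finset.mem_filter, Finset.mem_univ, true_and, h, e.isBlack_iff]

end ColorEnumeration

theorem nonempty_colorEnumeration {d L : ℕ} [NeZero L] (hd : 0 < d) (hL : Even L) :
    Nonempty (ColorEnumeration d L (halfVolume d L)) := by
  classical
  have h0 : IsBlack (0 : Torus d L) := by simp [IsBlack]
  have h1 : ¬ IsBlack (0 + Pi.single ⟨0, hd⟩ 1 : Torus d L) := by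
    rw [isBlack_add_single hL]
    exact not_not.2 h0
  have cw := card_oppositeColor hd hL (0 : Torus d L)
  have cb := card_oppositeColor hd hL (0 + Pi.single ⟨0, hd⟩ 1 : Torus d L)
  simp only [OppositeColor, isWhite_iff_not_isBlack, h0, h1, true_and, false_and, not_true,
    not_false_eq_true, or_false, false_or] at cw cb
  have eb : Fintype.card {x : Torus d L // IsBlack x} = halfVolume d L := by
    rw [Fintype.card_subtype, ← cb]
  have ew : Fintype.card {x : Torus d L // IsWhite x} = halfVolume d L := by
    rw [Fintype.card_subtype, ← cw]
    simp only [isWhite_iff_not_isBlack]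
  let b := (Fintype.equivFinOfCardEq eb).symm
  let w := (Fintype.equivFinOfCardEq ew).symm
  exact ⟨{
    black := fun i => b i
    white := fun i => w i
    black_injective := Subtype.val_injective.comp b.injective
    white_injective := Subtype.val_injective.comp w.injective
    isBlack_iff := fun x => ⟨fun h => ⟨b.symm ⟨x, h⟩, by simp⟩, by
      rintro ⟨i, rfl⟩
      exact (b i).2⟩
    isWhite_iff := fun x => ⟨fun h => ⟨w.symm ⟨x, h⟩, by simp⟩, by
      rintro ⟨i, rfl⟩
      exact (w i).2⟩ }⟩

/-! ### Pointwise bounds from smoothness, and comparison of partition functions. -/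

theorem IsUnitVector.neg {d L : ℕ} {u : Torus d L} (hu : IsUnitVector u) : IsUnitVector (-u) := by
  obtain ⟨i, rfl | rfl⟩ := hu
  · exact ⟨i, Or.inr rfl⟩
  · exact ⟨i, Or.inl (neg_neg _)⟩

theorem isBlack_add_two_mul_nsmul {d L : ℕ} [NeZero L] (hL : Even L) (x : Torus d L) (i : Fin d)
    (k : ℕ) : IsBlack (x + (2 * k) • Pi.single i 1) ↔ IsBlack x := by
  induction k with
  | zero => simp
  | succ k ih =>
    have h : x + (2 * (k + 1)) • (Pi.single i 1 : Torus d L) =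
        x + (2 * k) • Pi.single i 1 + Pi.single i 1 + Pi.single i 1 := by
      rw [mul_add, mul_one, add_nsmul, two_nsmul]
      abel
    rw [h, isBlack_add_single hL, isBlack_add_single hL, not_not, ih]

namespace Weighting

variable {d L : ℕ} [NeZero L] (f : Weighting d L)

theorem sm_nonneg (hd : 0 < d) : 0 ≤ f.sm := by
  have h := (abs_nonneg _).trans
    ((f.isLeast_sm hd).1 0 0 (Pi.single ⟨0, hd⟩ 1) ⟨⟨0, hd⟩, Or.inl rfl⟩)
  exact nonneg_of_mul_nonneg_left h (f.pos _ _)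

theorem toFun_add_nsmul_le (hd : 0 < d) (x y : Torus d L) {u : Torus d L} (hu : IsUnitVector u)
    (k : ℕ) : f.toFun x (y + k • u) ≤ (1 + f.sm) ^ k * f.toFun x y := by
  have hs := f.sm_nonneg hd
  induction k with
  | zero => simp
  | succ k ih =>
    have h := (abs_le.1 ((f.isLeast_sm hd).1 x (y + k • u) u hu)).1
    rw [add_nsmul, one_nsmul, ← add_assoc, pow_succ']
    calc f.toFun x (y + k • u + u) ≤ (1 + f.sm) * f.toFun x (y + k • u) := by linarith
      _ ≤ (1 + f.sm) * ((1 + f.sm) ^ k * f.toFun x y) :=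
        mul_le_mul_of_nonneg_left ih (by linarith)
      _ = _ := by ring

/-- A path from `y` to `z` takes fewer than `L` unit steps in each of the `d` directions. -/
theorem toFun_le_mul_toFun (hd : 0 < d) (x y z : Torus d L) :
    f.toFun x z ≤ (1 + f.sm) ^ (d * L) * f.toFun x y := by
  have hs := f.sm_nonneg hd
  have key : ∀ S : Finset (Fin d),
      f.toFun x (y + ∑ i ∈ S, ((z - y) i).val • (Pi.single i 1 : Torus d L)) ≤
        (1 + f.sm) ^ (S.card * L) * f.toFun x y := by
    intro S
    induction S using Finset.induction_on with
    | empty => simp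
    | insert i S hi ih =>
      rw [Finset.sum_insert hi, add_comm (((z - y) i).val • _), ← add_assoc,
        Finset.card_insert_of_notMem hi]
      refine (f.toFun_add_nsmul_le hd x _ ⟨i, Or.inl rfl⟩ _).trans ?_
      have h1 : (1 + f.sm) ^ ((z - y) i).val ≤ (1 + f.sm) ^ L :=
        pow_le_pow_right₀ (by linarith) (ZMod.val_lt _).le
      refine (mul_le_mul h1 ih (f.pos _ _).le (by positivity)).trans_eq ?_
      ring
  have h := key Finset.univ
  have e : y + ∑ i, ((z - y) i).val • (Pi.single i 1 : Torus d L) = z := by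
    have : ∑ i, ((z - y) i).val • (Pi.single i 1 : Torus d L) = z - y := by
      conv_rhs => rw [← Finset.univ_sum_single (z - y)]
      refine Finset.sum_congr rfl fun i _ => ?_
      rw [← Pi.single_smul, nsmul_eq_mul, mul_one, ZMod.natCast_zmod_val]
    rw [this]
    abel
  rwa [e, Finset.card_univ, Fintype.card_fin] at h

open Classical in
theorem halfVolume_mul_toFun_le (hd : 0 < d) (hL : Even L) (x z : Torus d L) :
    halfVolume d L * f.toFun x z ≤ (1 + f.sm) ^ (d * L) := by
  have h := Finset.sum_le_sum fun y (_ : y ∈ Finset.univ.filter fun y => OppositeColor x y) =>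
    f.toFun_le_mul_toFun hd x y z
  rwa [← Finset.mul_sum, f.normalized, mul_one, Finset.sum_const, card_oppositeColor hd hL,
    nsmul_eq_mul] at h

-- The `m` points `y + 2k e` with `k < m` are distinct because `2m ≤ L`, and have the color of `y`.
-- Their weights sum to at most 1, and each is at least `f(x, y) / (1 + sm f) ^ (2m)`.
open Classical in
theorem mul_toFun_le (hd : 0 < d) (hL : Even L) {m : ℕ} (hm : 2 * m ≤ L) {x y : Torus d L}
    (hxy : OppositeColor x y) : m * f.toFun x y ≤ (1 + f.sm) ^ (2 * m) := by
  have hs := f.sm_nonneg hd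
  let e : Torus d L := Pi.single ⟨0, hd⟩ 1
  have he : IsUnitVector e := ⟨_, Or.inl rfl⟩
  have h1 : ∀ k ∈ Finset.range m,
      f.toFun x y ≤ (1 + f.sm) ^ (2 * m) * f.toFun x (y + (2 * k) • e) := by
    intro k hk
    have h := f.toFun_add_nsmul_le hd x (y + (2 * k) • e) he.neg (2 * k)
    rw [smul_neg, add_neg_cancel_right] at h
    refine h.trans (mul_le_mul_of_nonneg_right ?_ (f.pos _ _).le)
    exact pow_le_pow_right₀ (by linarith) (by have := Finset.mem_range.1 hk; omega)
  have h2 : ∑ k ∈ Finset.range m, f.toFun x (y + (2 * k) • e) ≤ 1 := by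
    rw [← f.normalized x, ← Finset.sum_image (g := fun k => y + (2 * k) • e)
      (f := fun z => f.toFun x z)]
    · refine Finset.sum_le_sum_of_subset_of_nonneg ?_ fun _ _ _ => (f.pos _ _).le
      intro z hz
      obtain ⟨k, -, rfl⟩ := Finset.mem_image.1 hz
      simp only [Finset.mem_filter, Finset.mem_univ, true_and]
      simpa only [OppositeColor, isWhite_iff_not_isBlack, e, isBlack_add_two_mul_nsmul hL]
        using hxy
    · intro k hk l hl h
      have hk := Finset.mem_range.1 (Finset.mem_coe.1 hk)
      have hl := Finset.mem_range.1 (Finset.mem_coe.1 hl)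
      have h' := congrFun (add_left_cancel h) ⟨0, hd⟩
      simp only [e, Pi.smul_apply, Pi.single_eq_same, nsmul_eq_mul, mul_one] at h'
      have h'' := congrArg ZMod.val h'
      rw [ZMod.val_natCast_of_lt (by omega), ZMod.val_natCast_of_lt (by omega)] at h''
      omega
  have h3 := Finset.sum_le_sum h1
  rw [Finset.sum_const, Finset.card_range, nsmul_eq_mul, ← Finset.mul_sum] at h3
  exact h3.trans (mul_le_of_le_one_right (by positivity) h2)

theorem partitionFunction_const (hd : 0 < d) (hL : Even L) :
    (const hd hL).partitionFunction =
      ((halfVolume d L).factorial : ℝ) / (halfVolume d L : ℝ) ^ halfVolume d L := by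
  obtain ⟨e⟩ := nonempty_colorEnumeration (L := L) hd hL
  rw [e.partitionFunction_eq]
  simp [const, Fintype.card_perm, div_eq_mul_inv]

theorem partitionFunction_const_le (hd : 0 < d) (hL : Even L) :
    (const hd hL).partitionFunction ≤ f.partitionFunction := by
  obtain ⟨e⟩ := nonempty_colorEnumeration (L := L) hd hL
  rw [e.partitionFunction_eq f, partitionFunction_const]
  exact factorial_div_pow_le_sum_perm (fun i j => f.toFun (e.black i) (e.white j))
    (fun _ _ => f.pos _ _) (e.sum_white f) (e.sum_black f)

theorem partitionFunction_const_pos (hd : 0 < d) (hL : Even L) :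
    0 < (const hd hL).partitionFunction := by
  have : (0 : ℝ) < halfVolume d L := by exact_mod_cast halfVolume_pos hd hL
  rw [partitionFunction_const]
  positivity

theorem log_partitionFunction_sub_le_of_smooth (hd : 0 < d) (hL : Even L) :
    Real.log f.partitionFunction - Real.log (const hd hL).partitionFunction ≤
      halfVolume d L * (d * L * f.sm) := by
  obtain ⟨e⟩ := nonempty_colorEnumeration (L := L) hd hL
  have hs := f.sm_nonneg hd
  have hN : (0 : ℝ) < halfVolume d L := by exact_mod_cast halfVolume_pos hd hL
  have h0 := partitionFunction_const_pos hd hL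
  set K := (1 + f.sm) ^ (d * L) with hK
  have hK0 : 0 < K := by positivity
  have h1 : f.partitionFunction ≤ K ^ halfVolume d L * (const hd hL).partitionFunction := by
    rw [e.partitionFunction_eq f, partitionFunction_const]
    have h : ∀ σ : Equiv.Perm (Fin (halfVolume d L)),
        ∏ i, f.toFun (e.black i) (e.white (σ i)) ≤ (K / halfVolume d L) ^ halfVolume d L := by
      intro σ
      refine (Finset.prod_le_prod (fun _ _ => (f.pos _ _).le) fun i _ =>
        (le_div_iff₀' hN).2 (f.halfVolume_mul_toFun_le hd hL _ _)).trans_eq ?_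
      rw [Finset.prod_const, Finset.card_univ, Fintype.card_fin]
    refine (Finset.sum_le_sum fun σ _ => h σ).trans_eq ?_
    rw [Finset.sum_const, Finset.card_univ, Fintype.card_perm, Fintype.card_fin, nsmul_eq_mul,
      div_pow]
    ring
  have h2 := Real.log_le_log (h0.trans_le (f.partitionFunction_const_le hd hL)) h1
  rw [Real.log_mul (by positivity) h0.ne', Real.log_pow, hK, Real.log_pow] at h2
  have h3 := Real.log_le_sub_one_of_pos (show 0 < 1 + f.sm by linarith)
  rw [add_sub_cancel_left] at h3
  push_cast at h2
  have h4 : (halfVolume d L : ℝ) * (d * L * Real.log (1 + f.sm)) ≤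
      halfVolume d L * (d * L * f.sm) := by gcongr
  linarith

theorem log_partitionFunction_sub_le_of_small (hd : 0 < d) (hL : Even L) {η : ℝ}
    (hη : ∀ x y, OppositeColor x y → f.toFun x y ≤ η) :
    Real.log f.partitionFunction - Real.log (const hd hL).partitionFunction ≤
      4 * Real.sqrt η * halfVolume d L := by
  obtain ⟨e⟩ := nonempty_colorEnumeration (L := L) hd hL
  rw [e.partitionFunction_eq f, partitionFunction_const]
  exact log_sum_perm_sub_le (halfVolume_pos hd hL)
    (fun i j => f.toFun (e.black i) (e.white j)) (fun _ _ => f.pos _ _) (e.sum_white f)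
    fun i j => hη _ _ (Or.inl ⟨e.isBlack i, e.isWhite j⟩)

end Weighting

end Dimer

/-! ### Choice of `δ` and the two ranges of `L`. -/

theorem mainTheorem1 (d : ℕ) (hd : 0 < d) (ε : ℝ) (hε : 0 < ε) :
    ∃ δ : ℝ, 0 < δ ∧
      ∀ (L : ℕ) [NeZero L] (hL : Even L) (f : Dimer.Weighting d L),
        f.sm < δ → |f.pressure - (Dimer.Weighting.const hd hL).pressure| < ε := by
  -- With `η = 3 / m` this gives `√η < ε / 2`, so the error `4 √η N` is below `2 N ε`.
  obtain ⟨m, hm⟩ := exists_nat_gt (12 / ε ^ 2)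
  have hm0 : (0 : ℝ) < m := lt_of_le_of_lt (by positivity) hm
  have hd0 : (0 : ℝ) < d := by exact_mod_cast hd
  -- The first bound gives `(1 + sm f) ^ (2m) ≤ e ≤ 3` when `L ≥ 2m`; the second gives `d L sm f <
  -- ε` when `L < 2m`.
  refine ⟨min (1 / (2 * m)) (ε / (2 * d * m)), by positivity, ?_⟩
  intro L _ hL f hf
  have hs := f.sm_nonneg hd
  have hN : (0 : ℝ) < Dimer.halfVolume d L := by exact_mod_cast Dimer.halfVolume_pos hd hL
  have h0 := Dimer.Weighting.partitionFunction_const_pos (L := L) hd hL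
  have hlow := Real.log_le_log h0 (f.partitionFunction_const_le hd hL)
  have hup : Real.log f.partitionFunction -
      Real.log (Dimer.Weighting.const hd hL).partitionFunction <
        ε * (2 * Dimer.halfVolume d L) := by
    rcases le_or_gt (2 * m) L with hLm | hLm
    · have hexp : (1 + f.sm) ^ (2 * m) ≤ 3 := by
        have h1 : f.sm * (2 * m) ≤ 1 :=
          ((lt_div_iff₀ (by positivity)).1 (hf.trans_le (min_le_left _ _))).le
        calc (1 + f.sm) ^ (2 * m) ≤ Real.exp f.sm ^ (2 * m) := by
              have := Real.add_one_le_exp f.sm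
              exact pow_le_pow_left₀ (by linarith) (by linarith) _
          _ = Real.exp (f.sm * (2 * m)) := by
              rw [← Real.exp_nat_mul]
              push_cast
              ring_nf
          _ ≤ Real.exp 1 := Real.exp_le_exp.2 h1
          _ ≤ 3 := by linarith [Real.exp_one_lt_d9]
      have h1 := f.log_partitionFunction_sub_le_of_small hd hL (η := 3 / m) fun x y hxy =>
        (le_div_iff₀' hm0).2 ((f.mul_toFun_le hd hL hLm hxy).trans hexp)
      have h2 : Real.sqrt (3 / m) < ε / 2 := by
        rw [Real.sqrt_lt' (by positivity), div_lt_iff₀ hm0]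
        rw [div_lt_iff₀ (by positivity)] at hm
        nlinarith
      nlinarith
    · refine (f.log_partitionFunction_sub_le_of_smooth hd hL).trans_lt ?_
      have h1 : f.sm * (2 * d * m) < ε :=
        (lt_div_iff₀ (by positivity)).1 (hf.trans_le (min_le_right _ _))
      have h2 : (L : ℝ) ≤ 2 * m := by exact_mod_cast hLm.le
      have h3 : d * L * f.sm ≤ d * (2 * m) * f.sm := by gcongr
      nlinarith
  unfold Dimer.Weighting.pressure
  rw [← sub_div, abs_of_nonneg (div_nonneg (sub_nonneg.2 hlow) (by positivity)),
    div_lt_iff₀ (by positivity)]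
  exact hup
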